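/- Let $d\ge 2$ and $n\in\mathbb N_0$ be integers, with $n\le 1$ if $d=2$. For $h\ge 2$ let $P_m^h$ $(m\ge 0)$ be the Gegenbauer polynomials: $P_m^h$ has degree $m$, $P_m^h(1)=1$, and the $P_m^h$ are orthogonal on $[-1,1]$ with respect to $(1-t^2)^{\frac{h-3}{2}}\,dt$; also put $P_0^1=1$ and $P_1^1(t)=t$. For $x,y,z\in\mathbb S^{d-1}\subset\mathbb R^d$ write $u=\langle y,z\rangle$, $v=\langle x,z\rangle$, $t=\langle x,y\rangle$, and for $m,i,j\in\mathbb N_0$ let $$Q_m^d(u,v,t)=\big((1-u^2)(1-v^2)\big)^{m/2}\,P_m^{d-1}\!\left(\frac{t-uv}{\sqrt{(1-u^2)(1-v^2)}}\right),\qquad Y_{m,i,j}^d(x,y,z)=P_i^{d+2m}(u)\,P_j^{d+2m}(v)\,Q_m^d(u,v,t),$$ where, if $(1-u^2)(1-v^2)=0$, $Q_m^d(u,v,t)$ is read as $1$ for $m=0$ and as $0$ for $m\ge 1$ (the values of the polynomial that the formula represents). Let $S_m^d(x,y,z)$ be the infinite matrix with rows and columns indexed by $i,j\in\mathbb N_0$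 and entries $$S_{m,i,j}^d(x,y,z)=\frac16\sum_{\pi}Y_{m,i,j}^d(\pi(x),\pi(y),\pi(z)),$$ where $\pi$ runs over all permutations of $x,y,z$. For each $m\le n$ let $A_m$ be an infinite real symmetric positive semidefinite matrix, indexed by $\mathbb N_0\times\mathbb N_0$, with finitely many nonzero entries, and suppose that all entries in the first row and in the first column of $A_0$ are zero. Let $$K(x,y,z)=\sum_{m=0}^{n}\operatorname{Tr}\big(S_m^d(x,y,z)\,A_m\big).$$ Then for every Borel probability measure $\mu$ on $\mathbb S^{d-1}$ the energy integral $$I_K(\mu)=\int_{\mathbb S^{d-1}}\int_{\mathbb S^{d-1}}\int_{\mathbb S^{d-1}}K(x,y,z)\,d\mu(x)\,d\mu(y)\,d\mu(z)$$ converges absolutely, and the uniform probability measure $\sigma$ on $\mathbb S^{d-1}$ minimizes it: $I_K(\sigma)\le I_K(\mu)$ for every such $\mu$. -/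

import Mathlib

open MeasureTheory

namespace SphereEnergy

noncomputable section

/-- The unit sphere `𝕊^{d-1}` in Euclidean space `ℝ^d`. -/
abbrev Sphere (d : ℕ) : Type := Metric.sphere (0 : EuclideanSpace ℝ (Fin d)) 1

/-- The inner product `⟨x, y⟩` of two points of the sphere. -/
def ip {d : ℕ} (x y : Sphere d) : ℝ :=
  inner ℝ (x : EuclideanSpace ℝ (Fin d)) (y : EuclideanSpace ℝ (Fin d))

/-- The uniform probability measure on `𝕊^{d-1}`: surface measure divided by its total mass. -/
def uniform (d : ℕ) : Measure (Sphere d) :=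
  ((volume : Measure (EuclideanSpace ℝ (Fin d))).toSphere Set.univ)⁻¹ •
    (volume : Measure (EuclideanSpace ℝ (Fin d))).toSphere

/-- The Gegenbauer polynomial `P_m^h` of degree `m` on `𝕊^{h-1}` with `P_m^h(1) = 1`, by its
three-term recurrence `(m + h - 1) P_{m+2} = (2 m + h) t P_{m+1} - (m + 1) P_m`. For `h ≥ 2` these
are the polynomials orthogonal on `[-1, 1]` for the weight `(1 - t ^ 2) ^ ((h - 3) / 2)`, with value
`1` at `1`. For `h = 1` the values `P_0^1 = 1` and `P_1^1 = t` are the usual convention, and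
the further values have no meaning. -/
def gegenbauer (h : ℕ) : ℕ → Polynomial ℝ
  | 0 => 1
  | 1 => Polynomial.X
  | m + 2 =>
    Polynomial.C ((2 * (m : ℝ) + h) / ((m : ℝ) + h - 1)) * Polynomial.X * gegenbauer h (m + 1) -
      Polynomial.C (((m : ℝ) + 1) / ((m : ℝ) + h - 1)) * gegenbauer h m

/-- `Q_m^d(u, v, t) = ((1 - u²)(1 - v²))^{m/2} P_m^{d-1}((t - u v) / √((1 - u²)(1 - v²)))`.
On inner products of points of the sphere `(1 - u²)(1 - v²) ≥ 0`; where it is zero, also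
`t = u v`, and the polynomial that this expression represents is `1` for `m = 0` and `0` for
`m ≥ 1`, as is the value given here. -/
def Q (d m : ℕ) (u v t : ℝ) : ℝ :=
  Real.sqrt ((1 - u ^ 2) * (1 - v ^ 2)) ^ m *
    (gegenbauer (d - 1) m).eval ((t - u * v) / Real.sqrt ((1 - u ^ 2) * (1 - v ^ 2)))

/-- The infinite matrix `Y_m^d(x, y, z)`, with entries
`P_i^{d+2m}(u) P_j^{d+2m}(v) Q_m^d(u, v, t)`, where
`u = ⟨y, z⟩`, `v = ⟨x, z⟩`, `t = ⟨x, y⟩` (rows and columns are numbered from `0`). -/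
def Y (d m : ℕ) (x y z : Sphere d) : Matrix ℕ ℕ ℝ := fun i j =>
  (gegenbauer (d + 2 * m) i).eval (ip y z) * (gegenbauer (d + 2 * m) j).eval (ip x z) *
    Q d m (ip y z) (ip x z) (ip x y)

/-- The matrix `S_m^d(x, y, z)`: the average of `Y_m^d` over all permutations of `x, y, z`. -/
def S (d m : ℕ) (x y z : Sphere d) : Matrix ℕ ℕ ℝ := fun i j =>
  (1 / 6) * ∑ π : Equiv.Perm (Fin 3),
    Y d m (![x, y, z] (π 0)) (![x, y, z] (π 1)) (![x, y, z] (π 2)) i j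

/-- An infinite matrix with finitely many nonzero entries. -/
def FinitelySupported (A : Matrix ℕ ℕ ℝ) : Prop :=
  {p : ℕ × ℕ | A p.1 p.2 ≠ 0}.Finite

/-- `Tr (B A) = ∑ i, (B A)_{i i} = ∑ i, ∑ j, B_{i j} A_{j i}` for infinite matrices. If `A` has
finitely many nonzero entries, these are finite sums. -/
def trMul (B A : Matrix ℕ ℕ ℝ) : ℝ := ∑ᶠ i : ℕ, ∑ᶠ j : ℕ, B i j * A j i

/-- The kernel `K(x, y, z) = ∑_{m = 0}^{n} Tr (S_m^d(x, y, z) A_m)`. -/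
def kernel (d n : ℕ) (A : ℕ → Matrix ℕ ℕ ℝ) (x y z : Sphere d) : ℝ :=
  ∑ m ∈ Finset.range (n + 1), trMul (S d m x y z) (A m)

/-- The energy integral `I_K(μ) = ∫∫∫ K(x, y, z) dμ(x) dμ(y) dμ(z)`. -/
def energy {d : ℕ} (K : Sphere d → Sphere d → Sphere d → ℝ) (μ : Measure (Sphere d)) : ℝ :=
  ∫ z, ∫ y, ∫ x, K x y z ∂μ ∂μ ∂μ

end

end SphereEnergy

namespace SphereEnergy

open MvPolynomial

/-! The uniform measure has energy `0` and every probability measure has energy at least `0`. By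
Fubini the energy ignores permutations of the variables, so each `S` may be replaced by `Y`.

Fix `z` and project `x`, `y` to the hyperplane orthogonal to `z`, of dimension `h = d - 1`. The
factor `Q` becomes the zonal kernel `solid h m` of the two projections. This kernel is positive
definite: up to a positive constant it is the Fischer product of the zonal harmonics `zonal x m` and
`zonal y m` (`fischer_zonal`, `exists_features`). Hence the double integrals of `Y` over `x` and `y`
form a Gram matrix (`exists_integral_Y_eq_sum`), and pairing it with a positive semidefinite `A m`
gives a nonnegative number.

For the uniform measure the integral over `x` alone vanishes (`energy_Y_uniform`). As a function of
the pole it is a harmonic homogeneous polynomial, and reflections show that it is radial, so it is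
zero in positive degree (`eq_zero_of_radial`). The exception `m = 0`, `j = 0` is removed by the zero
row of `A 0`.

The condition `2 ≤ h ∨ m ≤ 1` recurs because for `h = 1` the recurrence divides by `m + h - 1 = 0`
at `m = 0`. -/

/-- The coefficient of `t P_{m+1}` in the Gegenbauer recurrence. -/
noncomputable def recA (h m : ℕ) : ℝ := (2 * (m : ℝ) + h) / ((m : ℝ) + h - 1)

/-- The coefficient of `P_m` in the Gegenbauer recurrence. -/
noncomputable def recB (h m : ℕ) : ℝ := ((m : ℝ) + 1) / ((m : ℝ) + h - 1)

/-- The homogenized Gegenbauer polynomial `s^{m/2} P_m^h(t / √s)`. -/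
noncomputable def solid (h : ℕ) : ℕ → ℝ → ℝ → ℝ
  | 0, _, _ => 1
  | 1, t, _ => t
  | m + 2, t, s => recA h m * t * solid h (m + 1) t s - recB h m * s * solid h m t s

/-! ### Zonal harmonics as polynomials, and their harmonicity. -/

section Polynomials

variable {h : ℕ}

/-- The linear form `⟨y, X⟩`. -/
noncomputable def linForm (y : Fin h → ℝ) : MvPolynomial (Fin h) ℝ := ∑ i, C (y i) * X i

/-- The quadratic form `|X|²`. -/
noncomputable def normForm (h : ℕ) : MvPolynomial (Fin h) ℝ := ∑ i, X i ^ 2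

/-- The Laplacian on polynomials. -/
noncomputable def laplacian (p : MvPolynomial (Fin h) ℝ) : MvPolynomial (Fin h) ℝ :=
  ∑ i, pderiv i (pderiv i p)

/-- The derivative in the direction `y`. -/
noncomputable def dirDeriv (y : Fin h → ℝ) (p : MvPolynomial (Fin h) ℝ) :
    MvPolynomial (Fin h) ℝ := ∑ i, C (y i) * pderiv i p

/-- The solid zonal harmonic of degree `m` with pole `y`. -/
noncomputable def zonal (y : Fin h → ℝ) : ℕ → MvPolynomial (Fin h) ℝ
  | 0 => 1
  | 1 => linForm y
  | m + 2 => C (recA h m) * linForm y * zonal y (m + 1) -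
      C (recB h m * ∑ i, y i ^ 2) * normForm h * zonal y m

theorem pderiv_linForm (y : Fin h → ℝ) (i : Fin h) : pderiv i (linForm y) = C (y i) := by
  classical
  simp [linForm, pderiv_X, Pi.single_apply]

theorem pderiv_normForm (i : Fin h) : pderiv i (normForm h) = C 2 * X i := by
  classical
  have h2 : (C 2 : MvPolynomial (Fin h) ℝ) = 2 := map_ofNat C 2
  simp [normForm, pderiv_X, Pi.single_apply, h2]

theorem dirDeriv_mul (y : Fin h → ℝ) (p q : MvPolynomial (Fin h) ℝ) :
    dirDeriv y (p * q) = dirDeriv y p * q + p * dirDeriv y q := by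
  simp only [dirDeriv, pderiv_mul, Finset.sum_mul, Finset.mul_sum, ← Finset.sum_add_distrib]
  exact Finset.sum_congr rfl fun i _ => by ring

theorem dirDeriv_sub (y : Fin h → ℝ) (p q : MvPolynomial (Fin h) ℝ) :
    dirDeriv y (p - q) = dirDeriv y p - dirDeriv y q := by
  simp only [dirDeriv, map_sub, mul_sub, Finset.sum_sub_distrib]

theorem dirDeriv_C (y : Fin h → ℝ) (a : ℝ) : dirDeriv y (C a) = 0 := by
  simp [dirDeriv]

theorem dirDeriv_linForm (y : Fin h → ℝ) : dirDeriv y (linForm y) = C (∑ i, y i ^ 2) := by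
  simp [dirDeriv, pderiv_linForm, sq]

theorem dirDeriv_normForm (y : Fin h → ℝ) : dirDeriv y (normForm h) = C 2 * linForm y := by
  simp only [dirDeriv, pderiv_normForm, linForm, Finset.mul_sum]
  exact Finset.sum_congr rfl fun i _ => by ring

theorem laplacian_sub (p q : MvPolynomial (Fin h) ℝ) :
    laplacian (p - q) = laplacian p - laplacian q := by
  simp only [laplacian, map_sub, Finset.sum_sub_distrib]

theorem laplacian_C_mul (a : ℝ) (p : MvPolynomial (Fin h) ℝ) :
    laplacian (C a * p) = C a * laplacian p := by
  simp only [laplacian, pderiv_C_mul, Finset.mul_sum]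

theorem laplacian_linForm_mul (y : Fin h → ℝ) (p : MvPolynomial (Fin h) ℝ) :
    laplacian (linForm y * p) = linForm y * laplacian p + C 2 * dirDeriv y p := by
  simp only [laplacian, dirDeriv, pderiv_mul, map_add, pderiv_linForm, pderiv_C,
    Finset.mul_sum, ← Finset.sum_add_distrib]
  refine Finset.sum_congr rfl fun i _ => ?_
  have : (C 2 : MvPolynomial (Fin h) ℝ) = 2 := map_ofNat C 2
  rw [this]; ring

theorem laplacian_normForm_mul {m : ℕ} {p : MvPolynomial (Fin h) ℝ} (hp : p.IsHomogeneous m) :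
    laplacian (normForm h * p) = normForm h * laplacian p + C (2 * (h : ℝ) + 4 * m) * p := by
  have he : ∑ i, X i * pderiv i p = C (m : ℝ) * p := by
    rw [hp.sum_X_mul_pderiv]; simp
  have h2 : (C 2 : MvPolynomial (Fin h) ℝ) = 2 := map_ofNat C 2
  have h4 : (C 4 : MvPolynomial (Fin h) ℝ) = 4 := map_ofNat C 4
  have key : ∀ i, pderiv i (pderiv i (normForm h * p)) =
      normForm h * pderiv i (pderiv i p) + (4 * (X i * pderiv i p) + 2 * p) := by
    intro i
    simp only [pderiv_mul, map_add, pderiv_normForm, pderiv_C, pderiv_X_self]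
    rw [h2]; ring
  simp only [laplacian, key, Finset.sum_add_distrib, ← Finset.mul_sum, he]
  simp only [Finset.sum_const, Finset.card_univ, Fintype.card_fin, nsmul_eq_mul, map_add, map_mul,
    h2, h4, map_natCast]
  ring

theorem isHomogeneous_linForm (y : Fin h → ℝ) : (linForm y).IsHomogeneous 1 :=
  IsHomogeneous.sum _ _ _ fun i _ => by
    simpa using (isHomogeneous_C (Fin h) (y i)).mul (isHomogeneous_X ℝ i)

theorem isHomogeneous_normForm : (normForm h).IsHomogeneous 2 :=
  IsHomogeneous.sum _ _ _ fun i _ => by simpa using (isHomogeneous_X ℝ i).pow 2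

theorem isHomogeneous_zonal (y : Fin h → ℝ) : ∀ m, (zonal y m).IsHomogeneous m
  | 0 => isHomogeneous_one _ _
  | 1 => isHomogeneous_linForm y
  | m + 2 => by
    have h1 := ((isHomogeneous_C (Fin h) (recA h m)).mul (isHomogeneous_linForm y)).mul
      (isHomogeneous_zonal y (m + 1))
    have h2 := ((isHomogeneous_C (Fin h) (recB h m * ∑ i, y i ^ 2)).mul
      isHomogeneous_normForm).mul (isHomogeneous_zonal y m)
    rw [show 0 + 1 + (m + 1) = m + 2 by ring] at h1
    rw [show 0 + 2 + m = m + 2 by ring] at h2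
    exact h1.sub h2

theorem eval_zonal (x y : Fin h → ℝ) : ∀ m, eval x (zonal y m) =
    solid h m (∑ i, x i * y i) ((∑ i, x i ^ 2) * ∑ i, y i ^ 2)
  | 0 => by simp [zonal, solid]
  | 1 => by simp [zonal, solid, linForm, mul_comm]
  | m + 2 => by
    simp only [zonal, solid, map_sub, map_mul, eval_C, eval_zonal x y (m + 1), eval_zonal x y m]
    simp only [linForm, normForm, map_sum, map_mul, eval_C, eval_X, map_pow, mul_comm (y _)]
    ring

/-- Differentiating along the pole lowers the degree. This supplies the cross term when the
Laplacian meets the product of `linForm y` and a zonal harmonic in the recurrence. -/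
theorem dirDeriv_zonal (y : Fin h → ℝ) : ∀ m, (2 ≤ h ∨ m = 0) →
    dirDeriv y (zonal y (m + 1)) = C ((m + 1) * ∑ i, y i ^ 2) * zonal y m
  | 0, _ => by simp [zonal, dirDeriv_linForm]
  | 1, hm => by
    have h2 : 2 ≤ h := by omega
    have h2' : (2 : ℝ) ≤ h := by exact_mod_cast h2
    have h0 : (h : ℝ) - 1 ≠ 0 := by linarith
    have e : recA h 0 * 2 - recB h 0 * 2 = 1 + 1 := by
      simp only [recA, recB, Nat.cast_zero, mul_zero, zero_add]
      field_simp; ring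
    simp only [zonal, dirDeriv_sub, dirDeriv_mul, dirDeriv_C, dirDeriv_linForm, dirDeriv_normForm]
    rw [← map_one C, dirDeriv_C]
    have := congrArg (C (σ := Fin h)) e
    simp only [map_sub, map_mul, map_one, map_add, Nat.cast_one] at this ⊢
    rw [show (C 2 : MvPolynomial (Fin h) ℝ) = 2 from map_ofNat C 2] at *
    linear_combination (C (∑ i, y i ^ 2) * linForm y) * this
  | m + 2, hm => by
    have h2 : 2 ≤ h := by omega
    have h2' : (2 : ℝ) ≤ h := by exact_mod_cast h2
    have hm0 : (0 : ℝ) ≤ m := m.cast_nonneg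
    have h0 : (m : ℝ) + h - 1 ≠ 0 := by linarith
    have h1 : (m : ℝ) + 1 + h - 1 ≠ 0 := by linarith
    -- After the product rule, the terms other than the multiple of `zonal y (m + 2)` are `c |y|²`
    -- times the recurrence for `zonal y (m + 2)`; `e2` and `e3` match its two coefficients and `e1`
    -- adds up the total.
    set c : ℝ := (m + 2) * (m + h - 1) / (m + 1 + h - 1) with hc
    have e1 : recA h (m + 1) + c = m + 3 := by
      simp only [recA, hc, Nat.cast_add, Nat.cast_one]; field_simp; ring
    have e2 : recA h (m + 1) * (m + 2) - 2 * recB h (m + 1) = c * recA h m := by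
      simp only [recA, recB, hc, Nat.cast_add, Nat.cast_one]; field_simp; ring
    have e3 : c * recB h m = recB h (m + 1) * (m + 1) := by
      simp only [recB, hc, Nat.cast_add, Nat.cast_one]; field_simp; ring
    have i1 := dirDeriv_zonal y (m + 1) (Or.inl h2)
    have i0 := dirDeriv_zonal y m (Or.inl h2)
    have hz : zonal y (m + 2) = C (recA h m) * linForm y * zonal y (m + 1) -
      C (recB h m * ∑ i, y i ^ 2) * normForm h * zonal y m := by rw [zonal]
    rw [zonal, dirDeriv_sub, dirDeriv_mul, dirDeriv_mul, dirDeriv_mul, dirDeriv_mul, i1, i0,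
      dirDeriv_C, dirDeriv_C, dirDeriv_linForm, dirDeriv_normForm]
    have e1' := congrArg (C (σ := Fin h)) e1
    have e2' := congrArg (C (σ := Fin h)) e2
    have e3' := congrArg (C (σ := Fin h)) e3
    have t2 : (C 2 : MvPolynomial (Fin h) ℝ) = 2 := map_ofNat C 2
    have t3 : (C 3 : MvPolynomial (Fin h) ℝ) = 3 := map_ofNat C 3
    simp only [map_sub, map_mul, map_one, map_add, Nat.cast_add, Nat.cast_one, Nat.cast_ofNat,
      t2, t3] at hz e1' e2' e3' ⊢
    linear_combination C (∑ i, y i ^ 2) * zonal y (m + 2) * e1' +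
      C (∑ i, y i ^ 2) * linForm y * zonal y (m + 1) * e2' +
      C (∑ i, y i ^ 2) * C (∑ i, y i ^ 2) * normForm h * zonal y m * e3' -
      C c * C (∑ i, y i ^ 2) * hz

theorem laplacian_zonal (y : Fin h → ℝ) : ∀ m, (2 ≤ h ∨ m ≤ 1) → laplacian (zonal y m) = 0
  | 0, _ => by simp [zonal, laplacian]
  | 1, _ => by simp [zonal, laplacian, pderiv_linForm]
  | m + 2, hm => by
    have h2 : 2 ≤ h := by omega
    have h2' : (2 : ℝ) ≤ h := by exact_mod_cast h2
    have hm0 : (0 : ℝ) ≤ m := m.cast_nonneg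
    have h0 : (m : ℝ) + h - 1 ≠ 0 := by linarith
    -- The cross term from `linForm y` cancels the Euler term from `normForm h`.
    have e : recA h m * 2 * (m + 1) = recB h m * (2 * h + 4 * m) := by
      simp only [recA, recB]; field_simp; ring
    have e' := congrArg (C (σ := Fin h)) e
    rw [zonal, laplacian_sub, mul_assoc, mul_assoc, laplacian_C_mul, laplacian_C_mul,
      laplacian_linForm_mul, laplacian_normForm_mul (isHomogeneous_zonal y m),
      laplacian_zonal y (m + 1) (Or.inl h2), laplacian_zonal y m (Or.inl h2),
      dirDeriv_zonal y m (Or.inl h2)]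
    simp only [map_mul, map_add, map_one] at e' ⊢
    linear_combination C (∑ i, y i ^ 2) * zonal y m * e'

/-! ### Leading term of a zonal harmonic and continuity in the pole. -/

/-- The leading coefficient of `P_m^h`. -/
noncomputable def leadCoeff (h : ℕ) : ℕ → ℝ
  | 0 => 1
  | 1 => 1
  | m + 2 => recA h m * leadCoeff h (m + 1)

theorem leadCoeff_pos (h : ℕ) : ∀ m, (2 ≤ h ∨ m ≤ 1) → 0 < leadCoeff h m
  | 0, _ => one_pos
  | 1, _ => one_pos
  | m + 2, hm => by
    have h2 : 2 ≤ h := by omega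
    have h2' : (2 : ℝ) ≤ h := by exact_mod_cast h2
    have hm0 : (0 : ℝ) ≤ m := m.cast_nonneg
    exact mul_pos (div_pos (by linarith) (by linarith)) (leadCoeff_pos h (m + 1) (Or.inl h2))

/-- Multiples of `normForm h` are Fischer-orthogonal to harmonic polynomials, so against these only
the power of `linForm y` counts. -/
theorem exists_zonal_eq (y : Fin h → ℝ) : ∀ m, ∃ r,
    zonal y m = C (leadCoeff h m) * linForm y ^ m + normForm h * r
  | 0 => ⟨0, by simp [zonal, leadCoeff]⟩
  | 1 => ⟨0, by simp [zonal, leadCoeff]⟩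
  | m + 2 => by
    obtain ⟨r, hr⟩ := exists_zonal_eq y (m + 1)
    refine ⟨C (recA h m) * linForm y * r - C (recB h m * ∑ i, y i ^ 2) * zonal y m, ?_⟩
    rw [zonal, hr, leadCoeff, map_mul C (recA h m)]
    ring

theorem continuous_coeff_mul {p q : (Fin h → ℝ) → MvPolynomial (Fin h) ℝ}
    (hp : ∀ α, Continuous fun y => coeff α (p y)) (hq : ∀ α, Continuous fun y => coeff α (q y))
    (α : Fin h →₀ ℕ) : Continuous fun y => coeff α (p y * q y) := by
  classical
  simp only [coeff_mul]
  exact continuous_finsetSum _ fun β _ => (hp _).mul (hq _)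

theorem continuous_coeff_linForm (α : Fin h →₀ ℕ) :
    Continuous fun y : Fin h → ℝ => coeff α (linForm y) := by
  simp only [linForm, coeff_sum, coeff_C_mul]
  fun_prop

theorem continuous_coeff_zonal : ∀ (m : ℕ) (α : Fin h →₀ ℕ),
    Continuous fun y : Fin h → ℝ => coeff α (zonal y m)
  | 0, α => by simp only [zonal]; fun_prop
  | 1, α => continuous_coeff_linForm α
  | m + 2, α => by
    simp only [zonal, coeff_sub, mul_assoc, coeff_C_mul]
    have h1 := continuous_coeff_mul continuous_coeff_linForm (continuous_coeff_zonal (m + 1)) α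
    have h2 := continuous_coeff_mul (fun α => continuous_const (y := coeff α (normForm h)))
      (continuous_coeff_zonal m) α
    fun_prop

/-! ### The Fischer product and the reproducing property. -/

/-- The factorial `α!` of a multi-index. -/
noncomputable def multiFactorial (α : Fin h →₀ ℕ) : ℝ := ∏ i, ((α i).factorial : ℝ)

theorem multiFactorial_pos (α : Fin h →₀ ℕ) : 0 < multiFactorial α :=
  Finset.prod_pos fun i _ => by exact_mod_cast (α i).factorial_pos

theorem multiFactorial_add_single (α : Fin h →₀ ℕ) (i : Fin h) :
    multiFactorial (α + Finsupp.single i 1) = (α i + 1) * multiFactorial α := by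
  classical
  rw [multiFactorial, multiFactorial, ← Finset.mul_prod_erase _ _ (Finset.mem_univ i),
    ← Finset.mul_prod_erase Finset.univ (fun j => ((α j).factorial : ℝ)) (Finset.mem_univ i),
    ← mul_assoc]
  congr 1
  · simp [Nat.factorial_succ]
  · refine Finset.prod_congr rfl fun j hj => ?_
    simp [(Finset.ne_of_mem_erase hj).symm]

/-- The Fischer product `p(∂) q (0) = ∑ α, α! p_α q_α` of polynomials. -/
noncomputable def fischer (p q : MvPolynomial (Fin h) ℝ) : ℝ :=
  ∑ α ∈ p.support, multiFactorial α * coeff α p * coeff α q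

theorem fischer_eq_sum {p : MvPolynomial (Fin h) ℝ} {T : Finset (Fin h →₀ ℕ)}
    (hT : p.support ⊆ T) (q : MvPolynomial (Fin h) ℝ) :
    fischer p q = ∑ α ∈ T, multiFactorial α * coeff α p * coeff α q :=
  Finset.sum_subset hT fun α _ hα => by rw [notMem_support_iff.1 hα]; ring

theorem fischer_add_left (p₁ p₂ q : MvPolynomial (Fin h) ℝ) :
    fischer (p₁ + p₂) q = fischer p₁ q + fischer p₂ q := by
  classical
  rw [fischer_eq_sum (support_add (p := p₁) (q := p₂)),
    fischer_eq_sum (Finset.subset_union_left (s₂ := p₂.support)),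
    fischer_eq_sum (Finset.subset_union_right (s₁ := p₁.support)), ← Finset.sum_add_distrib]
  exact Finset.sum_congr rfl fun α _ => by rw [coeff_add]; ring

theorem fischer_C_mul_left (a : ℝ) (p q : MvPolynomial (Fin h) ℝ) :
    fischer (C a * p) q = a * fischer p q := by
  have : (C a * p).support ⊆ p.support := by
    intro α
    simp only [mem_support_iff, coeff_C_mul]
    exact right_ne_zero_of_mul
  rw [fischer_eq_sum this, fischer, Finset.mul_sum]
  exact Finset.sum_congr rfl fun α _ => by rw [coeff_C_mul]; ring

theorem fischer_sum_left {ι : Type*} (s : Finset ι) (p : ι → MvPolynomial (Fin h) ℝ)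
    (q : MvPolynomial (Fin h) ℝ) : fischer (∑ i ∈ s, p i) q = ∑ i ∈ s, fischer (p i) q := by
  classical
  induction s using Finset.induction_on with
  | empty => simp [fischer]
  | insert i s hi ih => rw [Finset.sum_insert hi, Finset.sum_insert hi, fischer_add_left, ih]

theorem fischer_sum_right {ι : Type*} (s : Finset ι) (p : MvPolynomial (Fin h) ℝ)
    (q : ι → MvPolynomial (Fin h) ℝ) : fischer p (∑ i ∈ s, q i) = ∑ i ∈ s, fischer p (q i) := by
  simp only [fischer, coeff_sum, Finset.mul_sum]
  exact Finset.sum_comm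

theorem fischer_C_mul_right (a : ℝ) (p q : MvPolynomial (Fin h) ℝ) :
    fischer p (C a * q) = a * fischer p q := by
  rw [fischer, fischer, Finset.mul_sum]
  exact Finset.sum_congr rfl fun α _ => by rw [coeff_C_mul]; ring

theorem fischer_monomial (α : Fin h →₀ ℕ) (a : ℝ) (q : MvPolynomial (Fin h) ℝ) :
    fischer (monomial α a) q = multiFactorial α * a * coeff α q := by
  rw [fischer_eq_sum support_monomial_subset, Finset.sum_singleton, coeff_monomial, if_pos rfl]

/-- The weight `α!` absorbs exactly the exponent that differentiation brings down, which makes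
multiplication adjoint to differentiation. -/
theorem fischer_X_mul (i : Fin h) (p q : MvPolynomial (Fin h) ℝ) :
    fischer (X i * p) q = fischer p (pderiv i q) := by
  induction p using MvPolynomial.induction_on' with
  | monomial α a =>
    rw [X, monomial_mul, fischer_monomial, fischer_monomial, coeff_pderiv, add_comm _ α, one_mul,
      multiFactorial_add_single]
    ring
  | add p₁ p₂ h₁ h₂ => rw [mul_add, fischer_add_left, fischer_add_left, h₁, h₂]

theorem fischer_normForm_mul (p q : MvPolynomial (Fin h) ℝ) :
    fischer (normForm h * p) q = fischer p (laplacian q) := by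
  rw [normForm, laplacian, Finset.sum_mul, fischer_sum_left, fischer_sum_right]
  exact Finset.sum_congr rfl fun i _ => by rw [sq, mul_assoc, fischer_X_mul, fischer_X_mul]

theorem fischer_linForm_mul (y : Fin h → ℝ) (p q : MvPolynomial (Fin h) ℝ) :
    fischer (linForm y * p) q = fischer p (dirDeriv y q) := by
  rw [linForm, dirDeriv, Finset.sum_mul, fischer_sum_left, fischer_sum_right]
  exact Finset.sum_congr rfl fun i _ => by
    rw [mul_assoc, fischer_C_mul_left, fischer_X_mul, fischer_C_mul_right]

theorem isHomogeneous_dirDeriv (y : Fin h → ℝ) {m : ℕ} {q : MvPolynomial (Fin h) ℝ}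
    (hq : q.IsHomogeneous (m + 1)) : (dirDeriv y q).IsHomogeneous m :=
  IsHomogeneous.sum _ _ _ fun i _ => by
    simpa using (isHomogeneous_C (Fin h) (y i)).mul (hq.pderiv (i := i))

/-- Each factor `linForm y` moves across as a derivative along `y`; at the point `y` Euler's
identity turns that derivative into the degree, and the degrees multiply to `m!`. -/
theorem fischer_linForm_pow (y : Fin h → ℝ) : ∀ {m : ℕ} {q : MvPolynomial (Fin h) ℝ},
    q.IsHomogeneous m → fischer (linForm y ^ m) q = m.factorial * eval y q
  | 0, q, hq => by
    obtain ⟨a, rfl⟩ : ∃ a, q = C a := ⟨_, totalDegree_eq_zero_iff_eq_C.1 (Nat.le_zero.1 hq.totalDegree_le)⟩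
    have : (linForm y ^ 0 : MvPolynomial (Fin h) ℝ) = monomial 0 1 := by simp
    rw [this, fischer_monomial]
    simp [multiFactorial]
  | m + 1, q, hq => by
    rw [pow_succ', fischer_linForm_mul, fischer_linForm_pow y (isHomogeneous_dirDeriv y hq)]
    have he := congrArg (eval y) hq.sum_X_mul_pderiv
    simp only [map_sum, map_mul, eval_X, nsmul_eq_mul, map_natCast] at he
    simp only [dirDeriv, map_sum, map_mul, eval_C, he, Nat.factorial_succ]
    push_cast
    ring

theorem fischer_zonal {m : ℕ} (y : Fin h → ℝ) {q : MvPolynomial (Fin h) ℝ}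
    (hq : q.IsHomogeneous m) (hΔ : laplacian q = 0) :
    fischer (zonal y m) q = leadCoeff h m * m.factorial * eval y q := by
  obtain ⟨r, hr⟩ := exists_zonal_eq y m
  rw [hr, fischer_add_left, fischer_C_mul_left, fischer_linForm_pow y hq, fischer_normForm_mul, hΔ]
  simp [fischer, mul_assoc]

theorem support_subset_of_isHomogeneous {m : ℕ} {p : MvPolynomial (Fin h) ℝ}
    (hp : p.IsHomogeneous m) : p.support ⊆ Finset.finsuppAntidiag Finset.univ m := by
  intro α hα
  rw [Finset.mem_finsuppAntidiag]
  refine ⟨?_, Finset.subset_univ _⟩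
  have := hp (mem_support_iff.1 hα)
  rw [Finsupp.weight_apply, Finsupp.sum_fintype _ _ (by simp)] at this
  simpa using this

/-- The Gegenbauer kernel is positive definite: it has a finite-dimensional feature map. -/
theorem exists_features {m : ℕ} (hm : 2 ≤ h ∨ m ≤ 1) :
    ∃ φ : (Finset.finsuppAntidiag (Finset.univ : Finset (Fin h)) m) → (Fin h → ℝ) → ℝ,
      (∀ k, Continuous (φ k)) ∧ ∀ x y : Fin h → ℝ,
        solid h m (∑ i, x i * y i) ((∑ i, x i ^ 2) * ∑ i, y i ^ 2) = ∑ k, φ k x * φ k y := by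
  have hc : 0 < leadCoeff h m * m.factorial :=
    mul_pos (leadCoeff_pos h m hm) (by exact_mod_cast m.factorial_pos)
  refine ⟨fun k y => Real.sqrt (multiFactorial k.1 / (leadCoeff h m * m.factorial)) *
    coeff k.1 (zonal y m), fun k => continuous_const.mul (continuous_coeff_zonal m _),
    fun x y => ?_⟩
  -- The reproducing property applied to `zonal y m` itself writes the kernel as a coefficient sum
  -- with positive weights; the features carry the square roots of these weights.
  have hf := fischer_zonal x (isHomogeneous_zonal y m) (laplacian_zonal y m hm)
  rw [← eval_zonal, ← mul_right_inj' hc.ne', ← hf,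
    fischer_eq_sum (support_subset_of_isHomogeneous (isHomogeneous_zonal x m)),
    ← Finset.sum_coe_sort, Finset.mul_sum]
  refine Finset.sum_congr rfl fun k _ => ?_
  have := Real.mul_self_sqrt (div_nonneg (multiFactorial_pos k.1).le hc.le)
  have h2 : multiFactorial k.1 = (leadCoeff h m * m.factorial) *
    (multiFactorial k.1 / (leadCoeff h m * m.factorial)) :=
    (mul_div_cancel₀ _ hc.ne').symm
  rw [← this] at h2
  linear_combination coeff k.1 (zonal x m) * coeff k.1 (zonal y m) * h2

theorem eq_zero_of_fischer_self {p : MvPolynomial (Fin h) ℝ} (hp : fischer p p = 0) : p = 0 := by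
  rw [fischer, Finset.sum_eq_zero_iff_of_nonneg fun α _ => by
    rw [mul_assoc]; exact mul_nonneg (multiFactorial_pos α).le (mul_self_nonneg _)] at hp
  rw [← support_eq_empty, Finset.eq_empty_iff_forall_notMem]
  intro α hα
  have := hp α hα
  rw [mul_assoc] at this
  have h0 := mul_self_eq_zero.1 ((mul_eq_zero.1 this).resolve_left (multiFactorial_pos α).ne')
  exact mem_support_iff.1 hα h0

theorem eval_smul_of_isHomogeneous {m : ℕ} {p : MvPolynomial (Fin h) ℝ} (hp : p.IsHomogeneous m)
    (a : ℝ) (x : Fin h → ℝ) : eval (fun i => a * x i) p = a ^ m * eval x p := by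
  rw [eval_eq', eval_eq', Finset.mul_sum]
  refine Finset.sum_congr rfl fun α hα => ?_
  have := (Finset.mem_finsuppAntidiag.1 (support_subset_of_isHomogeneous hp hα)).1
  simp only [mul_pow, Finset.prod_mul_distrib, Finset.prod_pow_eq_pow_sum]
  rw [this]
  ring

/-- A harmonic homogeneous polynomial of positive degree that is constant on spheres vanishes. -/
theorem eq_zero_of_radial {m : ℕ} (hh : 0 < h) (hm : m ≠ 0) {p : MvPolynomial (Fin h) ℝ}
    (hp : p.IsHomogeneous m) (hΔ : laplacian p = 0)
    (hr : ∀ x y : Fin h → ℝ, ∑ i, x i ^ 2 = ∑ i, y i ^ 2 → eval x p = eval y p) : p = 0 := by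
  rcases Nat.even_or_odd' m with ⟨k, rfl | hk⟩
  · obtain ⟨l, rfl⟩ : ∃ l, k = l + 1 := ⟨k - 1, by omega⟩
    let e : Fin h → ℝ := Pi.single ⟨0, hh⟩ 1
    -- In even degree a radial polynomial is a multiple of a power of `|X|²`. One factor `|X|²` then
    -- passes to the other side as a Laplacian, so the Fischer square is zero.
    have hpe : p = C (eval e p) * normForm h ^ (l + 1) := by
      refine MvPolynomial.funext fun y => ?_
      have hy : 0 ≤ ∑ i, y i ^ 2 := Finset.sum_nonneg fun i _ => sq_nonneg _
      rw [hr y (fun i => Real.sqrt (∑ i, y i ^ 2) * e i), eval_smul_of_isHomogeneous hp, pow_mul,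
        Real.sq_sqrt hy]
      · simp only [map_mul, eval_C, map_pow, normForm, map_sum, eval_X]
        ring
      · simp only [mul_pow, ← Finset.mul_sum, Real.sq_sqrt hy]
        simp [e, Pi.single_apply]
    refine eq_zero_of_fischer_self ?_
    nth_rewrite 1 [hpe]
    rw [fischer_C_mul_left, pow_succ', fischer_normForm_mul, hΔ]
    simp [fischer]
  · refine MvPolynomial.funext fun y => ?_
    -- In odd degree, `-y` has the same norm as `y` but the opposite value.
    have h1 := eval_smul_of_isHomogeneous hp (-1) y
    rw [hr _ y (by simp), hk, Odd.neg_one_pow ⟨k, rfl⟩] at h1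
    rw [map_zero]
    linarith

end Polynomials

end SphereEnergy

/-! ### Averages of zonal harmonics and isometry invariance of the uniform measure. -/

namespace SphereEnergy

open MvPolynomial
open scoped Pointwise

theorem coeff_laplacian {h : ℕ} (q : MvPolynomial (Fin h) ℝ) (β : Fin h →₀ ℕ) :
    coeff β (laplacian q) = ∑ i : Fin h, (((β + Finsupp.single i 1 : Fin h →₀ ℕ) i : ℝ) + 1) * ((β i : ℝ) + 1) *
      coeff (β + Finsupp.single i 1 + Finsupp.single i 1) q := by
  simp only [laplacian, coeff_sum, coeff_pderiv]
  exact Finset.sum_congr rfl fun i _ => by ring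

theorem _root_.Continuous.integrable_of_compactSpace {X : Type*} [TopologicalSpace X]
    [CompactSpace X] [MeasurableSpace X] [OpensMeasurableSpace X] {ν : Measure X}
    [IsFiniteMeasure ν] {f : X → ℝ} (hf : Continuous f) : Integrable f ν :=
  hf.integrable_of_hasCompactSupport (HasCompactSupport.of_compactSpace f)

/-- If a weighted average of zonal harmonics with poles `ξ ω` is constant on spheres, it is zero. -/
theorem integral_zonal_eq_zero {X : Type*} [TopologicalSpace X] [CompactSpace X]
    [MeasurableSpace X] [OpensMeasurableSpace X] {ν : Measure X} [IsFiniteMeasure ν]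
    {h m : ℕ} (hh : 0 < h) (hm0 : m ≠ 0) (hm : 2 ≤ h ∨ m ≤ 1)
    {f : X → ℝ} (hf : Continuous f) {ξ : X → Fin h → ℝ} (hξ : Continuous ξ)
    (hinv : ∀ x y : Fin h → ℝ, ∑ i, x i ^ 2 = ∑ i, y i ^ 2 →
      ∫ ω, f ω * eval x (zonal (ξ ω) m) ∂ν = ∫ ω, f ω * eval y (zonal (ξ ω) m) ∂ν)
    (w : Fin h → ℝ) : ∫ ω, f ω * eval w (zonal (ξ ω) m) ∂ν = 0 := by
  classical
  let T := Finset.finsuppAntidiag (Finset.univ : Finset (Fin h)) m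
  -- The average is formed coefficientwise, so that it is an honest polynomial; homogeneity and
  -- harmonicity are linear in the coefficients and survive integration.
  let p : MvPolynomial (Fin h) ℝ := ∑ α ∈ T, monomial α (∫ ω, f ω * coeff α (zonal (ξ ω) m) ∂ν)
  have hc : ∀ α, Continuous fun ω => f ω * coeff α (zonal (ξ ω) m) := fun α =>
    hf.mul ((continuous_coeff_zonal m α).comp hξ)
  have hT : ∀ ω, ∀ α ∉ T, coeff α (zonal (ξ ω) m) = 0 := fun ω α hα =>
    notMem_support_iff.1 fun h =>
      hα (support_subset_of_isHomogeneous (isHomogeneous_zonal (ξ ω) m) h)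
  have hcoeff : ∀ α, coeff α p = ∫ ω, f ω * coeff α (zonal (ξ ω) m) ∂ν := by
    intro α
    simp only [p, coeff_sum, coeff_monomial, Finset.sum_ite_eq']
    split_ifs with hα
    · rfl
    · simp [hT _ α hα]
  have heval : ∀ x, eval x p = ∫ ω, f ω * eval x (zonal (ξ ω) m) ∂ν := by
    intro x
    have h1 : ∀ ω, f ω * eval x (zonal (ξ ω) m) =
        ∑ α ∈ T, (f ω * coeff α (zonal (ξ ω) m)) * ∏ i, x i ^ α i := by
      intro ω
      rw [eval_eq', Finset.sum_subset (support_subset_of_isHomogeneous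
        (isHomogeneous_zonal (ξ ω) m)) fun α _ hα => by rw [notMem_support_iff.1 hα, zero_mul],
        Finset.mul_sum]
      exact Finset.sum_congr rfl fun α _ => by ring
    simp only [h1]
    rw [integral_finsetSum _ fun α _ => ((hc α).integrable_of_compactSpace).mul_const _]
    simp only [integral_mul_const, p, map_sum, eval_monomial]
    refine Finset.sum_congr rfl fun α _ => ?_
    rw [Finsupp.prod_fintype _ _ (by simp)]
  have hhom : p.IsHomogeneous m := IsHomogeneous.sum _ _ _ fun α hα =>
    isHomogeneous_monomial _ (by
      rw [Finsupp.degree_eq_sum]; exact (Finset.mem_finsuppAntidiag.1 hα).1)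
  have hlap : laplacian p = 0 := by
    ext β
    rw [coeff_laplacian, coeff_zero]
    simp only [hcoeff, ← integral_const_mul]
    rw [← integral_finsetSum _ fun α _ => ((hc _).integrable_of_compactSpace).const_mul _]
    refine integral_eq_zero_of_ae (Filter.Eventually.of_forall fun ω => ?_)
    have h0 := coeff_laplacian (zonal (ξ ω) m) β
    rw [laplacian_zonal _ m hm, coeff_zero] at h0
    have := congrArg (f ω * ·) h0
    simp only [mul_zero, Finset.mul_sum] at this
    simp only [Pi.zero_apply]
    rw [this]
    exact Finset.sum_congr rfl fun i _ => by ring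
  rw [← heval, eq_zero_of_radial hh hm0 hhom hlap fun x y hxy => by
    rw [heval, heval, hinv x y hxy], map_zero]

/-- The action of a linear isometry on the sphere. -/
noncomputable def sphereMap {d : ℕ} (R : EuclideanSpace ℝ (Fin d) ≃ₗᵢ[ℝ] EuclideanSpace ℝ (Fin d))
    (x : Sphere d) : Sphere d := ⟨R x, by simp⟩

theorem continuous_sphereMap {d : ℕ}
    (R : EuclideanSpace ℝ (Fin d) ≃ₗᵢ[ℝ] EuclideanSpace ℝ (Fin d)) : Continuous (sphereMap R) :=
  (R.continuous.comp continuous_subtype_val).subtype_mk _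

/-- Surface measure is defined through the volume of the cone over a set; a linear isometry commutes
with taking cones and preserves volume. -/
theorem map_sphereMap_uniform {d : ℕ}
    (R : EuclideanSpace ℝ (Fin d) ≃ₗᵢ[ℝ] EuclideanSpace ℝ (Fin d)) :
    (uniform d).map (sphereMap R) = uniform d := by
  rw [uniform, Measure.map_smul]
  congr 1
  ext s hs
  have hm := (continuous_sphereMap R).measurable
  have he : Set.Ioo (0 : ℝ) 1 • ((↑) '' (sphereMap R ⁻¹' s) : Set (EuclideanSpace ℝ (Fin d))) =
      R.toMeasurableEquiv ⁻¹' (Set.Ioo (0 : ℝ) 1 • ((↑) '' s)) := by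
    ext x
    simp only [Set.mem_smul, Set.mem_image, Set.mem_preimage]
    constructor
    · rintro ⟨r, hr, _, ⟨y, hy, rfl⟩, rfl⟩
      exact ⟨r, hr, _, ⟨_, hy, rfl⟩, (R.map_smul r (y : EuclideanSpace ℝ (Fin d))).symm⟩
    · rintro ⟨r, hr, _, ⟨y, hy, rfl⟩, hx⟩
      refine ⟨r, hr, _, ⟨sphereMap R.symm y, ?_, rfl⟩, ?_⟩
      · convert hy
        ext1; simp [sphereMap]
      · have : R x = r • (y : EuclideanSpace ℝ (Fin d)) := hx.symm
        rw [← R.symm_apply_apply x, this, map_smul]; rfl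
  have hR : MeasurePreserving R.toMeasurableEquiv
    (volume : Measure (EuclideanSpace ℝ (Fin d))) volume := R.measurePreserving
  rw [Measure.map_apply hm hs, Measure.toSphere_apply' _ (hm hs), Measure.toSphere_apply' _ hs,
    he, hR.measure_preimage_equiv]

theorem integral_comp_sphereMap {d : ℕ}
    (R : EuclideanSpace ℝ (Fin d) ≃ₗᵢ[ℝ] EuclideanSpace ℝ (Fin d)) {f : Sphere d → ℝ}
    (hf : Continuous f) : ∫ x, f (sphereMap R x) ∂uniform d = ∫ x, f x ∂uniform d := by
  conv_rhs => rw [← map_sphereMap_uniform R]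
  rw [integral_map (continuous_sphereMap R).measurable.aemeasurable hf.aestronglyMeasurable]

theorem isProbabilityMeasure_uniform {d : ℕ} (hd : 0 < d) : IsProbabilityMeasure (uniform d) := by
  have : NeZero d := ⟨hd.ne'⟩
  have : NeZero (volume : Measure (EuclideanSpace ℝ (Fin d))).toSphere :=
    ⟨Measure.toSphere_ne_zero _⟩
  rw [uniform]
  infer_instance

theorem continuous_solid (h : ℕ) : ∀ m, Continuous fun p : ℝ × ℝ => solid h m p.1 p.2
  | 0 => continuous_const
  | 1 => continuous_fst
  | m + 2 => by
    simp only [solid]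
    have h1 := continuous_solid h (m + 1)
    have h2 := continuous_solid h m
    fun_prop

theorem continuous_ip {d : ℕ} : Continuous fun p : Sphere d × Sphere d => ip p.1 p.2 := by
  unfold ip; fun_prop

/-! ### Vanishing integrals for the uniform measure. -/

/-- The integral of a solid harmonic in an orthonormal system `b` against a weight that is
invariant under all isometries that fix the complement of `b` vanishes. -/
theorem integral_solid_orthonormal {d h m : ℕ} (hd : 0 < d) (hh : 0 < h) (hm0 : m ≠ 0)
    (hm : 2 ≤ h ∨ m ≤ 1) {b : Fin h → EuclideanSpace ℝ (Fin d)} (hb : Orthonormal ℝ b)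
    {f s : Sphere d → ℝ} (hf : Continuous f)
    (hs : ∀ x : Sphere d, ∑ i, inner ℝ (b i) (x : EuclideanSpace ℝ (Fin d)) ^ 2 = s x)
    (hR : ∀ R : EuclideanSpace ℝ (Fin d) ≃ₗᵢ[ℝ] EuclideanSpace ℝ (Fin d),
      (∀ v, (∀ i, inner ℝ (b i) v = 0) → R v = v) →
        ∀ x, f (sphereMap R x) = f x ∧ s (sphereMap R x) = s x) (w : Fin h → ℝ) :
    ∫ x, f x * solid h m (inner ℝ (∑ i, w i • b i) (x : EuclideanSpace ℝ (Fin d)))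
      ((∑ i, w i ^ 2) * s x) ∂uniform d = 0 := by
  have := isProbabilityMeasure_uniform hd
  let ξ : Sphere d → Fin h → ℝ := fun x i => inner ℝ (b i) (x : EuclideanSpace ℝ (Fin d))
  have hξ : Continuous ξ := continuous_pi fun i => by unfold ξ; fun_prop
  have hev : ∀ (w : Fin h → ℝ) (x : Sphere d), eval w (zonal (ξ x) m) =
      solid h m (inner ℝ (∑ i, w i • b i) (x : EuclideanSpace ℝ (Fin d)))
        ((∑ i, w i ^ 2) * s x) := by
    intro w x
    rw [eval_zonal, hs]
    simp only [ξ, sum_inner, real_inner_smul_left]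
  have key := integral_zonal_eq_zero (ν := uniform d) hh hm0 hm hf hξ ?_ w
  · simpa only [hev] using key
  intro w₁ w₂ hw
  simp only [hev]
  set a₁ := ∑ i, w₁ i • b i with ha₁
  set a₂ := ∑ i, w₂ i • b i with ha₂
  have hn : ‖a₁‖ = ‖a₂‖ := by
    rw [← sq_eq_sq₀ (norm_nonneg _) (norm_nonneg _), ← real_inner_self_eq_norm_sq,
      ← real_inner_self_eq_norm_sq, ha₁, ha₂, hb.inner_sum, hb.inner_sum]
    simpa [sq] using hw
  -- The reflection exchanging `a₁` and `a₂` fixes everything orthogonal to `b`, so it leaves `f`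
  -- and `s` invariant while moving one pole to the other.
  let R := (ℝ ∙ (a₁ - a₂))ᗮ.reflection
  have hRa : R a₁ = a₂ := Submodule.reflection_sub hn
  have hfix : ∀ v, (∀ i, inner ℝ (b i) v = 0) → R v = v := by
    intro v hv
    rw [Submodule.reflection_eq_self_iff, Submodule.mem_orthogonal_singleton_iff_inner_right]
    simp [ha₁, ha₂, inner_sub_left, sum_inner, real_inner_smul_left, hv]
  have hss : Continuous s := by
    have : s = fun x => ∑ i, ξ x i ^ 2 := funext fun x => (hs x).symm
    rw [this]; fun_prop
  have hcont : Continuous fun x : Sphere d => f x *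
      solid h m (inner ℝ a₂ (x : EuclideanSpace ℝ (Fin d))) ((∑ i, w₂ i ^ 2) * s x) :=
    hf.mul ((continuous_solid h m).comp (Continuous.prodMk (by fun_prop) (by fun_prop)))
  rw [← integral_comp_sphereMap R hcont]
  refine integral_congr_ae (Filter.Eventually.of_forall fun x => ?_)
  simp only
  rw [(hR R hfix x).1, (hR R hfix x).2, hw, ← hRa]
  congr 2
  exact (R.inner_map_map _ _).symm

theorem exists_orthonormalBasis_zero {h : ℕ} (z : Sphere (h + 1)) :
    ∃ b : OrthonormalBasis (Fin (h + 1)) ℝ (EuclideanSpace ℝ (Fin (h + 1))), b 0 = z := by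
  obtain ⟨b, hb⟩ := Orthonormal.exists_orthonormalBasis_extension_of_card_eq (𝕜 := ℝ)
    (ι := Fin (h + 1)) (E := EuclideanSpace ℝ (Fin (h + 1))) (by simp)
    (v := fun _ => (z : EuclideanSpace ℝ (Fin (h + 1)))) (s := {0}) (by
      constructor
      · intro i; simp
      · intro i j hij; exact absurd (Subsingleton.elim i j) hij)
  exact ⟨b, hb 0 rfl⟩

theorem ip_self {d : ℕ} (x : Sphere d) : ip x x = 1 := by
  simp [ip]

theorem ip_comm {d : ℕ} (x y : Sphere d) : ip x y = ip y x := real_inner_comm _ _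

/-- Parseval without the `z` term: the inner product of the projections to the hyperplane orthogonal
to `z`. -/
theorem sum_inner_succ {h : ℕ} {z : Sphere (h + 1)}
    {b : OrthonormalBasis (Fin (h + 1)) ℝ (EuclideanSpace ℝ (Fin (h + 1)))} (hb : b 0 = z)
    (x y : Sphere (h + 1)) :
    ∑ i : Fin h, inner ℝ (b i.succ) (x : EuclideanSpace ℝ (Fin (h + 1))) *
      inner ℝ (b i.succ) (y : EuclideanSpace ℝ (Fin (h + 1))) = ip x y - ip x z * ip y z := by
  have := b.sum_inner_mul_inner (x : EuclideanSpace ℝ (Fin (h + 1))) y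
  have e : ∀ i, inner ℝ (x : EuclideanSpace ℝ (Fin (h + 1))) (b i) = inner ℝ (b i) x.1 :=
    fun i => real_inner_comm _ _
  simp only [e] at this
  rw [Fin.sum_univ_succ, hb] at this
  rw [ip_comm x z, ip_comm y z, ip, ip, ip]
  linarith

/-- The weight sees `x` only through its component along `z`, hence is invariant under isometries
fixing `z`; the pole is the projection of `y`. -/
theorem integral_mul_solid_eq_zero {h m : ℕ} (hh : 0 < h) (hm0 : m ≠ 0) (hm : 2 ≤ h ∨ m ≤ 1)
    {g : ℝ → ℝ} (hg : Continuous g) (y z : Sphere (h + 1)) :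
    ∫ x, g (ip x z) * solid h m (ip x y - ip y z * ip x z)
      ((1 - ip y z ^ 2) * (1 - ip x z ^ 2)) ∂uniform (h + 1) = 0 := by
  obtain ⟨b, hb⟩ := exists_orthonormalBasis_zero z
  have key := integral_solid_orthonormal (d := h + 1) (Nat.succ_pos h) hh hm0 hm
    (b := fun i => b i.succ) (b.orthonormal.comp _ (Fin.succ_injective h))
    (f := fun x => g (ip x z)) (s := fun x => 1 - ip x z ^ 2)
    (hg.comp (continuous_ip.comp (continuous_id.prodMk continuous_const)))
    (fun x => by
      have := sum_inner_succ hb x x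
      rw [ip_self] at this
      simpa only [sq] using this)
    (fun R hR x => by
      have hz : R z = z := hR z fun i => by
        rw [← hb]; exact b.orthonormal.2 (Fin.succ_ne_zero i)
      have : ip (sphereMap R x) z = ip x z := by
        rw [ip, sphereMap]
        nth_rewrite 1 [← hz]
        exact R.inner_map_map _ _
      simp only [this, and_self])
    (fun i => inner ℝ (b i.succ) (y : EuclideanSpace ℝ (Fin (h + 1))))
  rw [← key]
  refine integral_congr_ae (Filter.Eventually.of_forall fun x => ?_)
  simp only [sum_inner, real_inner_smul_left]
  rw [sum_inner_succ hb y x]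
  have h2 := sum_inner_succ hb y y
  rw [ip_self] at h2
  simp only [sq, h2, ip_comm y x]

theorem integral_solid_eq_zero {d m : ℕ} (hd : 2 ≤ d) (hm0 : m ≠ 0) (z : Sphere d) :
    ∫ x, solid d m (ip x z) 1 ∂uniform d = 0 := by
  let b := EuclideanSpace.basisFun (Fin d) ℝ
  have hp : ∀ x : Sphere d, ∑ i, inner ℝ (b i) (x : EuclideanSpace ℝ (Fin d)) ^ 2 = 1 := by
    intro x
    have := b.sum_sq_inner_right (x : EuclideanSpace ℝ (Fin d))
    simpa using this
  have key := integral_solid_orthonormal (d := d) (by omega) (by omega) hm0 (Or.inl hd)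
    b.orthonormal (f := fun _ => 1) (s := fun _ => 1) continuous_const hp
    (fun R hR x => ⟨rfl, rfl⟩) (fun i => inner ℝ (b i) (z : EuclideanSpace ℝ (Fin d)))
  rw [← key]
  refine integral_congr_ae (Filter.Eventually.of_forall fun x => ?_)
  simp only [b.sum_repr', hp, mul_one, one_mul]
  rw [ip_comm]; rfl

end SphereEnergy

/-! ### `Y` as a continuous function, without square roots or division. -/

namespace SphereEnergy

theorem pow_mul_eval_gegenbauer (h : ℕ) {r : ℝ} (hr : r ≠ 0) (t : ℝ) :
    ∀ m, r ^ m * (gegenbauer h m).eval (t / r) = solid h m t (r ^ 2)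
  | 0 => by simp [gegenbauer, solid]
  | 1 => by simp [gegenbauer, solid, mul_div_cancel₀ _ hr]
  | m + 2 => by
    simp only [solid, ← pow_mul_eval_gegenbauer h hr t (m + 1), ← pow_mul_eval_gegenbauer h hr t m,
      gegenbauer, Polynomial.eval_sub, Polynomial.eval_mul, Polynomial.eval_C, Polynomial.eval_X,
      recA, recB]
    generalize (gegenbauer h (m + 1)).eval (t / r) = p
    generalize (gegenbauer h m).eval (t / r) = q
    have : t = r * (t / r) := (mul_div_cancel₀ _ hr).symm
    generalize t / r = c at *
    rw [this]
    ring

theorem eval_gegenbauer (h m : ℕ) (t : ℝ) : (gegenbauer h m).eval t = solid h m t 1 := by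
  simpa using pow_mul_eval_gegenbauer h one_ne_zero t m

theorem solid_zero_zero (h : ℕ) : ∀ m, solid h m 0 0 = 0 ^ m
  | 0 => by simp [solid]
  | 1 => by simp [solid]
  | m + 2 => by simp [solid]

theorem ip_sq_le_one {d : ℕ} (x y : Sphere d) : ip x y ^ 2 ≤ 1 := by
  have := abs_real_inner_le_norm (x : EuclideanSpace ℝ (Fin d)) y
  rw [norm_eq_of_mem_sphere, norm_eq_of_mem_sphere, one_mul] at this
  exact (sq_le_one_iff_abs_le_one _).2 this

/-- Cauchy–Schwarz for the projections of `x` and `y`. -/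
theorem sq_sub_le {h : ℕ} (x y z : Sphere (h + 1)) :
    (ip x y - ip y z * ip x z) ^ 2 ≤ (1 - ip y z ^ 2) * (1 - ip x z ^ 2) := by
  obtain ⟨b, hb⟩ := exists_orthonormalBasis_zero z
  have hxx := sum_inner_succ hb x x
  have hyy := sum_inner_succ hb y y
  rw [ip_self] at hxx hyy
  have := Finset.sum_mul_sq_le_sq_mul_sq Finset.univ
    (fun i : Fin h => inner ℝ (b i.succ) (x : EuclideanSpace ℝ (Fin (h + 1))))
    (fun i => inner ℝ (b i.succ) (y : EuclideanSpace ℝ (Fin (h + 1))))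
  simp only [sum_inner_succ hb x y, sq, hxx, hyy] at this ⊢
  linarith

theorem Q_eq_solid {h m : ℕ} (x y z : Sphere (h + 1)) :
    Q (h + 1) m (ip y z) (ip x z) (ip x y) =
      solid h m (ip x y - ip y z * ip x z) ((1 - ip y z ^ 2) * (1 - ip x z ^ 2)) := by
  have hs : 0 ≤ (1 - ip y z ^ 2) * (1 - ip x z ^ 2) :=
    mul_nonneg (sub_nonneg.2 (ip_sq_le_one y z)) (sub_nonneg.2 (ip_sq_le_one x z))
  have hle := sq_sub_le x y z
  rw [Q, Nat.add_sub_cancel]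
  rcases hs.eq_or_lt with h0 | hpos
  -- If the root is zero, so is the numerator; the quotient takes the value `0`, and the power of
  -- the root leaves `0 ^ m` on both sides.
  · rw [← h0] at hle ⊢
    have ht := pow_eq_zero_iff (two_ne_zero) |>.1 (le_antisymm hle (sq_nonneg _))
    rw [ht, solid_zero_zero, Real.sqrt_zero, div_zero, eval_gegenbauer]
    rcases m with _ | m
    · simp [solid]
    · simp
  · rw [pow_mul_eval_gegenbauer h (Real.sqrt_pos.2 hpos).ne', Real.sq_sqrt hs]

theorem Y_eq_solid {h m : ℕ} (x y z : Sphere (h + 1)) (i j : ℕ) :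
    Y (h + 1) m x y z i j = solid (h + 1 + 2 * m) i (ip y z) 1 * solid (h + 1 + 2 * m) j (ip x z) 1 *
      solid h m (ip x y - ip y z * ip x z) ((1 - ip y z ^ 2) * (1 - ip x z ^ 2)) := by
  rw [Y, Q_eq_solid, eval_gegenbauer, eval_gegenbauer]

theorem continuous_solid_comp {X : Type*} [TopologicalSpace X] (h m : ℕ) {t s : X → ℝ}
    (ht : Continuous t) (hs : Continuous s) : Continuous fun x => solid h m (t x) (s x) :=
  (continuous_solid h m).comp (ht.prodMk hs)

theorem continuous_ip_comp {X : Type*} [TopologicalSpace X] {d : ℕ} {x y : X → Sphere d}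
    (hx : Continuous x) (hy : Continuous y) : Continuous fun a => ip (x a) (y a) :=
  continuous_ip.comp (hx.prodMk hy)

theorem continuous_Y_comp {X : Type*} [TopologicalSpace X] {h : ℕ} (m i j : ℕ)
    {x y z : X → Sphere (h + 1)} (hx : Continuous x) (hy : Continuous y) (hz : Continuous z) :
    Continuous fun a => Y (h + 1) m (x a) (y a) (z a) i j := by
  simp only [Y_eq_solid]
  have h1 := continuous_ip_comp hy hz
  have h2 := continuous_ip_comp hx hz
  have h3 := continuous_ip_comp hx hy
  exact ((continuous_solid_comp _ _ h1 continuous_const).mul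
    (continuous_solid_comp _ _ h2 continuous_const)).mul
    (continuous_solid_comp _ _ (by fun_prop) (by fun_prop))

/-! ### Fubini and symmetrization of the energy. -/

section Energy

variable {d : ℕ} {μ : Measure (Sphere d)} [IsProbabilityMeasure μ]

theorem energy_eq_integral_prod {F : Sphere d → Sphere d → Sphere d → ℝ}
    (hF : Continuous fun p : Sphere d × Sphere d × Sphere d => F p.1 p.2.1 p.2.2) :
    energy F μ = ∫ p : Sphere d × Sphere d × Sphere d, F p.2.2 p.2.1 p.1 ∂μ.prod (μ.prod μ) := by
  have hc : Continuous fun p : Sphere d × Sphere d × Sphere d => F p.2.2 p.2.1 p.1 :=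
    hF.comp (f := fun p : Sphere d × Sphere d × Sphere d => (p.2.2, p.2.1, p.1)) (by fun_prop)
  rw [energy, integral_prod _ hc.integrable_of_compactSpace]
  refine integral_congr_ae (Filter.Eventually.of_forall fun z => ?_)
  simp only
  have hz : Continuous fun q : Sphere d × Sphere d => F q.2 q.1 z :=
    hF.comp (f := fun q : Sphere d × Sphere d => (q.2, q.1, z)) (by fun_prop)
  rw [integral_prod _ hz.integrable_of_compactSpace]

theorem energy_sum {ι : Type*} (s : Finset ι) (c : ι → ℝ)
    {F : ι → Sphere d → Sphere d → Sphere d → ℝ}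
    (hF : ∀ k, Continuous fun p : Sphere d × Sphere d × Sphere d => F k p.1 p.2.1 p.2.2) :
    energy (fun x y z => ∑ k ∈ s, c k * F k x y z) μ = ∑ k ∈ s, c k * energy (F k) μ := by
  rw [energy_eq_integral_prod (by fun_prop)]
  have hc : ∀ k, Continuous fun p : Sphere d × Sphere d × Sphere d => F k p.2.2 p.2.1 p.1 :=
    fun k => (hF k).comp (f := fun p : Sphere d × Sphere d × Sphere d => (p.2.2, p.2.1, p.1)) (by fun_prop)
  rw [integral_finsetSum _ fun k _ => ((hc k).integrable_of_compactSpace).const_mul _]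
  exact Finset.sum_congr rfl fun k _ => by rw [integral_const_mul, energy_eq_integral_prod (hF k)]

theorem energy_swap_left {F : Sphere d → Sphere d → Sphere d → ℝ}
    (hF : Continuous fun p : Sphere d × Sphere d × Sphere d => F p.1 p.2.1 p.2.2) :
    energy (fun x y z => F y x z) μ = energy F μ := by
  refine integral_congr_ae (Filter.Eventually.of_forall fun z => ?_)
  refine integral_integral_swap (f := fun y x => F y x z) ?_
  have hz : Continuous fun q : Sphere d × Sphere d => F q.1 q.2 z :=
    hF.comp (f := fun q : Sphere d × Sphere d => (q.1, q.2, z)) (by fun_prop)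
  exact hz.integrable_of_compactSpace

theorem energy_swap_right {F : Sphere d → Sphere d → Sphere d → ℝ}
    (hF : Continuous fun p : Sphere d × Sphere d × Sphere d => F p.1 p.2.1 p.2.2) :
    energy (fun x y z => F x z y) μ = energy F μ := by
  refine integral_integral_swap (f := fun z y => ∫ x, F x z y ∂μ) ?_
  have hc : Continuous fun q : (Sphere d × Sphere d) × Sphere d => F q.2 q.1.1 q.1.2 :=
    hF.comp (f := fun q : (Sphere d × Sphere d) × Sphere d => (q.2, q.1.1, q.1.2)) (by fun_prop)
  exact (hc.integrable_of_compactSpace (ν := (μ.prod μ).prod μ)).integral_prod_left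

/-- Every permutation of three points is a product of the two adjacent transpositions, each of which
is one use of Fubini. -/
theorem energy_perm {F : Sphere d → Sphere d → Sphere d → ℝ}
    (hF : Continuous fun p : Sphere d × Sphere d × Sphere d => F p.1 p.2.1 p.2.2)
    (π : Equiv.Perm (Fin 3)) :
    energy (fun x y z => F (![x, y, z] (π 0)) (![x, y, z] (π 1)) (![x, y, z] (π 2))) μ =
      energy F μ := by
  have h213 : Continuous fun p : Sphere d × Sphere d × Sphere d => F p.2.1 p.1 p.2.2 :=
    hF.comp (f := fun p : Sphere d × Sphere d × Sphere d => (p.2.1, p.1, p.2.2)) (by fun_prop)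
  have h132 : Continuous fun p : Sphere d × Sphere d × Sphere d => F p.1 p.2.2 p.2.1 :=
    hF.comp (f := fun p : Sphere d × Sphere d × Sphere d => (p.1, p.2.2, p.2.1)) (by fun_prop)
  have h231 : Continuous fun p : Sphere d × Sphere d × Sphere d => F p.2.1 p.2.2 p.1 :=
    hF.comp (f := fun p : Sphere d × Sphere d × Sphere d => (p.2.1, p.2.2, p.1)) (by fun_prop)
  have hπ : (π 0 = 0 ∧ π 1 = 1 ∧ π 2 = 2) ∨ (π 0 = 1 ∧ π 1 = 0 ∧ π 2 = 2) ∨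
      (π 0 = 0 ∧ π 1 = 2 ∧ π 2 = 1) ∨ (π 0 = 1 ∧ π 1 = 2 ∧ π 2 = 0) ∨
      (π 0 = 2 ∧ π 1 = 0 ∧ π 2 = 1) ∨ (π 0 = 2 ∧ π 1 = 1 ∧ π 2 = 0) := by
    revert π; decide
  have e1 := energy_swap_left (μ := μ) hF
  have e2 := energy_swap_right (μ := μ) hF
  rcases hπ with ⟨h0, h1, h2⟩ | ⟨h0, h1, h2⟩ | ⟨h0, h1, h2⟩ | ⟨h0, h1, h2⟩ | ⟨h0, h1, h2⟩ |
      ⟨h0, h1, h2⟩ <;> rw [h0, h1, h2]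
  · rfl
  · exact e1
  · exact e2
  · exact (energy_swap_left h132).trans e2
  · exact (energy_swap_right h213).trans e1
  · exact (energy_swap_right h231).trans ((energy_swap_left h132).trans e2)

end Energy

theorem continuous_vec3 {X : Type*} [TopologicalSpace X] (k : Fin 3) :
    Continuous fun p : X × X × X => (![p.1, p.2.1, p.2.2] : Fin 3 → X) k := by
  fin_cases k
  · exact continuous_fst
  · exact continuous_fst.comp continuous_snd
  · exact continuous_snd.comp continuous_snd

theorem continuous_S {h : ℕ} (m i j : ℕ) :
    Continuous fun p : Sphere (h + 1) × Sphere (h + 1) × Sphere (h + 1) =>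
      S (h + 1) m p.1 p.2.1 p.2.2 i j := by
  exact continuous_const.mul (continuous_finsetSum _ fun π _ =>
    continuous_Y_comp m i j (continuous_vec3 _)
      (continuous_vec3 _) (continuous_vec3 _))

theorem energy_S {h : ℕ} (m i j : ℕ) (μ : Measure (Sphere (h + 1))) [IsProbabilityMeasure μ] :
    energy (fun x y z => S (h + 1) m x y z i j) μ =
      energy (fun x y z => Y (h + 1) m x y z i j) μ := by
  have hY : Continuous fun p : Sphere (h + 1) × Sphere (h + 1) × Sphere (h + 1) =>
    Y (h + 1) m p.1 p.2.1 p.2.2 i j := continuous_Y_comp m i j (by fun_prop) (by fun_prop)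
      (by fun_prop)
  simp only [S, Finset.mul_sum]
  rw [energy_sum Finset.univ (fun _ : Equiv.Perm (Fin 3) => (1 / 6 : ℝ))
    (F := fun π x y z => Y (h + 1) m (![x, y, z] (π 0)) (![x, y, z] (π 1)) (![x, y, z] (π 2)) i j)
    fun π => continuous_Y_comp m i j (continuous_vec3 _)
      (continuous_vec3 _) (continuous_vec3 _)]
  simp only [energy_perm (F := fun x y z => Y (h + 1) m x y z i j) hY]
  simp [Finset.card_univ, Fintype.card_perm, Nat.factorial]

/-! ### Nonnegativity for every measure, and value zero for the uniform one. -/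

/-- For fixed `z`, the matrix of the `Y_{m,i,j}`-energies is a Gram matrix. -/
theorem exists_integral_Y_eq_sum {h m : ℕ} (hm : 2 ≤ h ∨ m ≤ 1) (μ : Measure (Sphere (h + 1)))
    [IsProbabilityMeasure μ] (z : Sphere (h + 1)) :
    ∃ (ι : Type) (_ : Fintype ι) (a : ι → ℕ → ℝ), ∀ i j,
      ∫ y, ∫ x, Y (h + 1) m x y z i j ∂μ ∂μ = ∑ k, a k i * a k j := by
  obtain ⟨b, hb⟩ := exists_orthonormalBasis_zero z
  obtain ⟨φ, hφ, hsum⟩ := exists_features (h := h) hm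
  let ξ : Sphere (h + 1) → Fin h → ℝ :=
    fun x i => inner ℝ (b i.succ) (x : EuclideanSpace ℝ (Fin (h + 1)))
  have hξ : Continuous ξ := continuous_pi fun i => by unfold ξ; fun_prop
  let ψ := fun k i x => solid (h + 1 + 2 * m) i (ip x z) 1 * φ k (ξ x)
  have hψ : ∀ k i, Continuous (ψ k i) := fun k i =>
    (continuous_solid_comp _ _ (continuous_ip_comp continuous_id continuous_const)
      continuous_const).mul ((hφ k).comp hξ)
  have hY : ∀ x y i j, Y (h + 1) m x y z i j = ∑ k, ψ k i y * ψ k j x := by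
    intro x y i j
    have h1 := hsum (ξ x) (ξ y)
    have hxx := sum_inner_succ hb x x
    have hyy := sum_inner_succ hb y y
    have hxy := sum_inner_succ hb x y
    rw [ip_self, ← sq] at hxx hyy
    simp only [ξ, sq] at h1 hxx hyy
    rw [hxx, hyy, hxy] at h1
    rw [Y_eq_solid, sq, sq, mul_comm (ip y z) (ip x z), mul_comm (1 - ip y z * ip y z), h1,
      Finset.mul_sum]
    exact Finset.sum_congr rfl fun k _ => by simp only [ψ, ξ]; ring
  refine ⟨_, inferInstance, fun k i => ∫ x, ψ k i x ∂μ, fun i j => ?_⟩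
  have h1 : ∀ y, ∫ x, Y (h + 1) m x y z i j ∂μ = ∑ k, ψ k i y * ∫ x, ψ k j x ∂μ := by
    intro y
    simp only [hY]
    rw [integral_finsetSum _ fun k _ => ((hψ k j).integrable_of_compactSpace).const_mul _]
    simp only [integral_const_mul]
  simp only [h1]
  rw [integral_finsetSum _ fun k _ => ((hψ k i).integrable_of_compactSpace).mul_const _]
  simp only [integral_mul_const]

theorem sum_mul_nonneg_of_posSemidef {A : Matrix ℕ ℕ ℝ} (hA : A.PosSemidef) (N : ℕ) (a : ℕ → ℝ) :
    0 ≤ ∑ i ∈ Finset.range N, ∑ j ∈ Finset.range N, A j i * (a i * a j) := by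
  classical
  -- Positive semidefiniteness of an infinite matrix is tested on finitely supported vectors, so `a`
  -- is cut off at `N`.
  let x : ℕ →₀ ℝ := Finsupp.onFinset (Finset.range N) (fun i => if i < N then a i else 0)
    (fun i hi => by
      rw [Finset.mem_range]
      by_contra h
      simp [h] at hi)
  have hx : x.support ⊆ Finset.range N := Finsupp.support_onFinset_subset
  have := hA.2 x
  have hin : ∀ i, (x.sum fun j xj => star (x i) * A i j * xj) =
      ∑ j ∈ Finset.range N, star (x i) * A i j * x j := fun i =>
    Finsupp.sum_of_support_subset _ hx _ (by simp)
  rw [Finsupp.sum_of_support_subset _ hx _ (by simp)] at this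
  simp only [hin] at this
  rw [Finset.sum_comm]
  refine this.trans_eq (Finset.sum_congr rfl fun i hi => Finset.sum_congr rfl fun j hj => ?_)
  rw [Finset.mem_range] at hi hj
  simp only [x, Finsupp.onFinset_apply, hi, hj, if_true, star_trivial]
  ring

/-- Nonnegativity holds already for each fixed `z`, before the outer integration. -/
theorem energy_sum_Y_nonneg {h m : ℕ} (hm : 2 ≤ h ∨ m ≤ 1) {A : Matrix ℕ ℕ ℝ}
    (hA : A.PosSemidef) (N : ℕ) (μ : Measure (Sphere (h + 1))) [IsProbabilityMeasure μ] :
    0 ≤ ∑ q ∈ Finset.range N ×ˢ Finset.range N,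
      A q.2 q.1 * energy (fun x y z => Y (h + 1) m x y z q.1 q.2) μ := by
  rw [← energy_sum (F := fun (q : ℕ × ℕ) x y z => Y (h + 1) m x y z q.1 q.2)
    _ (fun q : ℕ × ℕ => A q.2 q.1) fun q =>
    continuous_Y_comp m q.1 q.2 (by fun_prop) (by fun_prop) (by fun_prop)]
  refine integral_nonneg fun z => ?_
  obtain ⟨ι, _, a, ha⟩ := exists_integral_Y_eq_sum hm μ z
  have hc : ∀ i j, Continuous fun p : Sphere (h + 1) × Sphere (h + 1) =>
      Y (h + 1) m p.2 p.1 z i j := fun i j =>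
    continuous_Y_comp m i j (by fun_prop) (by fun_prop) (by fun_prop)
  have h1 : ∀ y, ∫ x, ∑ q ∈ Finset.range N ×ˢ Finset.range N, A q.2 q.1 *
      Y (h + 1) m x y z q.1 q.2 ∂μ = ∑ q ∈ Finset.range N ×ˢ Finset.range N, A q.2 q.1 *
      ∫ x, Y (h + 1) m x y z q.1 q.2 ∂μ := by
    intro y
    rw [integral_finsetSum _ fun q _ => (Continuous.integrable_of_compactSpace
      ((hc q.1 q.2).comp (Continuous.prodMk_right y))).const_mul _]
    simp only [integral_const_mul]
  simp only [h1]
  rw [integral_finsetSum _ fun q _ =>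
    ((hc q.1 q.2).integrable_of_compactSpace (ν := μ.prod μ)).integral_prod_left.const_mul _]
  simp only [integral_const_mul, ha, Finset.mul_sum, Pi.zero_apply]
  rw [Finset.sum_comm]
  refine Finset.sum_nonneg fun k _ => ?_
  rw [Finset.sum_product]
  exact sum_mul_nonneg_of_posSemidef hA N (a k)

/-- The integral over `x` already vanishes. For `m = 0` the only dependence on `x` is the Gegenbauer
factor of index `j`, which averages to zero unless it is constant. -/
theorem energy_Y_uniform {h m i j : ℕ} (hh : 0 < h) (hm : 2 ≤ h ∨ m ≤ 1) (hj : m = 0 → j ≠ 0) :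
    energy (fun x y z => Y (h + 1) m x y z i j) (uniform (h + 1)) = 0 := by
  refine integral_eq_zero_of_ae (Filter.Eventually.of_forall fun z => ?_)
  refine integral_eq_zero_of_ae (Filter.Eventually.of_forall fun y => ?_)
  simp only [Y_eq_solid, mul_assoc, Pi.zero_apply]
  rw [integral_const_mul]
  refine mul_eq_zero_of_right _ ?_
  rcases eq_or_ne m 0 with rfl | hm0
  · simpa [solid] using integral_solid_eq_zero (d := h + 1) (by omega) (hj rfl) z
  · exact integral_mul_solid_eq_zero hh hm0 hm
      (g := fun t => solid (h + 1 + 2 * m) j t 1)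
      (continuous_solid_comp _ _ continuous_id continuous_const) y z

/-! ### Traces as finite sums, and the theorem. -/

theorem FinitelySupported.exists_bound {A : Matrix ℕ ℕ ℝ} (hA : FinitelySupported A) :
    ∃ N, ∀ M, N ≤ M → ∀ i j, A i j ≠ 0 → i < M ∧ j < M := by
  obtain ⟨⟨a, b⟩, hab⟩ := hA.bddAbove
  refine ⟨max a b + 1, fun M hM i j hij => ?_⟩
  have : (i, j) ≤ (a, b) := hab hij
  have h1 : i ≤ a := this.1
  have h2 : j ≤ b := this.2
  omega

theorem trMul_eq_sum {A : Matrix ℕ ℕ ℝ} {N : ℕ} (hN : ∀ i j, A i j ≠ 0 → i < N ∧ j < N)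
    (B : Matrix ℕ ℕ ℝ) :
    trMul B A = ∑ q ∈ Finset.range N ×ˢ Finset.range N, A q.2 q.1 * B q.1 q.2 := by
  have h1 : ∀ i, ∑ᶠ j, B i j * A j i = ∑ j ∈ Finset.range N, B i j * A j i := fun i =>
    finsum_eq_sum_of_support_subset _ fun j hj => by
      simpa using (hN j i (right_ne_zero_of_mul hj)).1
  rw [trMul, finsum_eq_sum_of_support_subset (s := Finset.range N), Finset.sum_product]
  · refine Finset.sum_congr rfl fun i _ => (h1 i).trans ?_
    exact Finset.sum_congr rfl fun j _ => mul_comm _ _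
  · intro i hi
    rw [Function.mem_support, h1] at hi
    obtain ⟨j, _, hj⟩ := Finset.exists_ne_zero_of_sum_ne_zero hi
    simpa using (hN j i (right_ne_zero_of_mul hj)).2

end SphereEnergy

theorem theorem4p1 (d n : ℕ) (hd : 2 ≤ d) (hdn : d = 2 → n ≤ 1)
    (A : ℕ → Matrix ℕ ℕ ℝ)
    (hpsd : ∀ m ≤ n, (A m).PosSemidef)
    (hfin : ∀ m ≤ n, SphereEnergy.FinitelySupported (A m))
    (hA0 : ∀ i, A 0 0 i = 0 ∧ A 0 i 0 = 0) :
    IsProbabilityMeasure (SphereEnergy.uniform d) ∧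
      ∀ μ : Measure (SphereEnergy.Sphere d), IsProbabilityMeasure μ →
        Integrable (fun p : SphereEnergy.Sphere d × SphereEnergy.Sphere d × SphereEnergy.Sphere d =>
            SphereEnergy.kernel d n A p.1 p.2.1 p.2.2) (μ.prod (μ.prod μ)) ∧
          SphereEnergy.energy (SphereEnergy.kernel d n A) (SphereEnergy.uniform d) ≤
            SphereEnergy.energy (SphereEnergy.kernel d n A) μ := by
  open SphereEnergy in
  obtain ⟨h, rfl⟩ : ∃ h, d = h + 1 := ⟨d - 1, by omega⟩
  have hprob := isProbabilityMeasure_uniform (d := h + 1) (by omega)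
  -- For `d = 2` the hyperplane is a line, and `n ≤ 1` keeps to the degrees `0` and `1`.
  have hm : ∀ m ≤ n, 2 ≤ h ∨ m ≤ 1 := fun m hmn => by omega
  obtain ⟨N, hN⟩ : ∃ N, ∀ m ≤ n, ∀ i j, A m i j ≠ 0 → i < N ∧ j < N := by
    choose! N hN using fun m hmn => (hfin m hmn).exists_bound
    exact ⟨(Finset.range (n + 1)).sup N, fun m hmn =>
      hN m hmn _ (Finset.le_sup (Finset.mem_range.2 (by omega)))⟩
  have hker : kernel (h + 1) n A = fun x y z =>
      ∑ r ∈ Finset.range (n + 1) ×ˢ (Finset.range N ×ˢ Finset.range N),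
        A r.1 r.2.2 r.2.1 * S (h + 1) r.1 x y z r.2.1 r.2.2 := by
    funext x y z
    rw [kernel, Finset.sum_product]
    exact Finset.sum_congr rfl fun m hmn =>
      trMul_eq_sum (hN m (by rw [Finset.mem_range] at hmn; omega)) _
  have hcont : Continuous fun p : Sphere (h + 1) × Sphere (h + 1) × Sphere (h + 1) =>
      kernel (h + 1) n A p.1 p.2.1 p.2.2 := by
    rw [hker]
    exact continuous_finsetSum _ fun r _ => continuous_const.mul (continuous_S _ _ _)
  have hen : ∀ (μ : Measure (Sphere (h + 1))) [IsProbabilityMeasure μ],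
      energy (kernel (h + 1) n A) μ = ∑ m ∈ Finset.range (n + 1),
        ∑ q ∈ Finset.range N ×ˢ Finset.range N,
          A m q.2 q.1 * energy (fun x y z => Y (h + 1) m x y z q.1 q.2) μ := by
    intro μ _
    rw [hker, energy_sum (F := fun (r : ℕ × ℕ × ℕ) x y z => S (h + 1) r.1 x y z r.2.1 r.2.2)
      _ (fun r : ℕ × ℕ × ℕ => A r.1 r.2.2 r.2.1) fun r => continuous_S _ _ _, Finset.sum_product]
    simp only [energy_S]
  refine ⟨hprob, fun μ hμ => ⟨hcont.integrable_of_compactSpace, ?_⟩⟩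
  have hle : ∀ m ∈ Finset.range (n + 1), m ≤ n := fun m hmn => by
    rw [Finset.mem_range] at hmn; omega
  rw [hen μ, hen (uniform (h + 1)), Finset.sum_eq_zero]
  · exact Finset.sum_nonneg fun m hmn =>
      energy_sum_Y_nonneg (hm m (hle m hmn)) (hpsd m (hle m hmn)) N μ
  · refine fun m hmn => Finset.sum_eq_zero fun q _ => ?_
    -- The constant term is the only one whose uniform energy need not vanish; its coefficient lies
    -- in the zero row of `A 0`.
    by_cases hj : m = 0 ∧ q.2 = 0
    · rw [hj.1, hj.2, (hA0 q.1).1, zero_mul]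
    · rw [energy_Y_uniform (by omega) (hm m (hle m hmn)) fun h0 h1 => hj ⟨h0, h1⟩, mul_zero]
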